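/- Let $R$ be a Dedekind domain (fields are allowed), and let $M$ and $N$ be finitely generated $R$-modules. For modules $A,B$ over a commutative ring $S$, let $\mathrm{sur}_S(A,B)\in\{0,1,2,\dots,\infty\}$ denote the supremum of the nonnegative integers $t$ for which there is a surjective $S$-linear map $A\to B^{\oplus t}$. If $M$ is not torsion and $r:=\mathrm{rank}(M)$, let $[M]$ denote the Steinitz class of $M$, that is, the class in the ideal class group of $R$ of a nonzero ideal $I$ such that $M/\mathrm{Tor}(M)\cong R^{\oplus(r-1)}\oplus I$, where $\mathrm{Tor}(M)$ is the torsion submodule of $M$; define $[N]$ likewise if $N$ is not torsion. Let $X:=\mathrm{Ass}_R(N)-\{0\}$ be the set of nonzero associated primes of $N$. Then $\mathrm{sur}_R(M,N)=0$ if and only if at least one of the following conditions holds: (1) $\mathrm{sur}_{R_{\mathfrak m}}(M_{\mathfrak m},N_{\mathfrak m})=0$ for some $\mathfrak m\in X$; (2) $\mathrm{rank}(N)\geqslant 1+\mathrm{rank}(M)$; (3) $\mathrm{rank}(M)=\mathrm{rank}(N)\geqslant 1$ and $[M]\neq[N]$. -/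

import Mathlib

/-- The global surjective capacity `sur_R(M, N)`: the supremum in `{0, 1, 2, …, ∞}` of the natural
numbers `t` for which there is a surjective `R`-linear map from `M` to the direct sum of `t`
copies of `N`. -/
noncomputable def surjectiveCapacity (R M N : Type*) [CommRing R] [AddCommGroup M] [Module R M]
    [AddCommGroup N] [Module R N] : ℕ∞ :=
  ⨆ (t : ℕ) (_ : ∃ f : M →ₗ[R] (Fin t → N), Function.Surjective f), (t : ℕ∞)

/-- The local surjective capacity of `M` with respect to `N` at a prime `p`: the surjective capacity
of the localized modules `M_p` and `N_p` over the localized ring `R_p`. -/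
noncomputable def localSurjectiveCapacity (R M N : Type*) [CommRing R] [AddCommGroup M] [Module R M]
    [AddCommGroup N] [Module R N] (p : PrimeSpectrum R) : ℕ∞ :=
  surjectiveCapacity (Localization.AtPrime p.asIdeal)
    (LocalizedModule p.asIdeal.primeCompl M) (LocalizedModule p.asIdeal.primeCompl N)

/-- The nonzero ideal `I` represents the Steinitz class of `M`: the quotient of `M` by its torsion
submodule is isomorphic to the direct sum of `rank M - 1` copies of `R` and of `I`. -/
def RepresentsSteinitzClass (R M : Type*) [CommRing R] [IsDedekindDomain R] [AddCommGroup M]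
    [Module R M] (I : nonZeroDivisors (Ideal R)) : Prop :=
  Nonempty ((M ⧸ Submodule.torsion R M) ≃ₗ[R]
    ((Fin (Module.finrank R M - 1) → R) × (I : Ideal R)))

open Classical in
/-- The Steinitz class `[M]` of a finitely generated module `M` over a Dedekind domain `R`: the class
of a nonzero ideal `I` with `M / Tor(M)` isomorphic to `R ^ (rank M - 1) ⊕ I`. By the structure
theorem such an ideal exists and is unique up to isomorphism if `M` is finitely generated and not
torsion; in the remaining cases there is no Steinitz class, and the value is the dummy `1`. -/
noncomputable def steinitzClass (R M : Type*) [CommRing R] [IsDedekindDomain R] [AddCommGroup M]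
    [Module R M] : ClassGroup R :=
  if h : ∃ I : nonZeroDivisors (Ideal R), RepresentsSteinitzClass R M I then
    ClassGroup.mk0 h.choose
  else 1

/-! Zero capacity means that there is no surjection `M → N`. A surjection localizes, bounds the rank
of `N`, and in equal rank induces an isomorphism modulo torsion, so each of the three conditions
excludes one. Conversely, suppose that all three fail. The conditions on rank and class give a
surjection `g` from `M` onto `N / Tor(N)` (`exists_surjective_quotient_torsion`). As this quotient
is projective, `g` lifts to a map `M → N`, which can fail to be surjective only at the finitely many
primes of `X`, where `N` has torsion. At `m ∈ X` there is a local surjection; since `R_m` is a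
principal ideal domain, an automorphism of `M_m` makes it compatible with `g`
(`exists_lift_of_surjective_localized`). Clearing denominators, the Chinese remainder theorem and
Nakayama's lemma merge these maps with the lift into one surjection
(`exists_surjective_of_finite_isMaximal`). -/

open Module Submodule

/-! ### Surjections onto projective modules and automorphisms of the source. -/

section Splitting

variable {R U L : Type*} [CommRing R] [AddCommGroup U] [Module R U] [AddCommGroup L] [Module R L]

/-- A surjection onto a projective module is a product projection up to isomorphism. -/
theorem LinearMap.exists_equiv_ker_prod [Projective R L] (p : U →ₗ[R] L)
    (hp : Function.Surjective p) :
    ∃ e : U ≃ₗ[R] (LinearMap.ker p × L), ∀ u, (e u).2 = p u := by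
  obtain ⟨s, hs⟩ := p.exists_rightInverse_of_surjective (LinearMap.range_eq_top.2 hp)
  obtain ⟨e, -, he⟩ := (p.exact_subtype_ker_map).splitSurjectiveEquiv
    (Submodule.injective_subtype _) ⟨s, hs⟩
  exact ⟨e, fun u => (LinearMap.congr_fun he u).symm⟩

theorem finrank_eq_add_of_surjective [IsDomain R] [Module.Finite R U] (p : U →ₗ[R] L)
    (hp : Function.Surjective p) :
    finrank R U = finrank R L + finrank R (LinearMap.ker p) := by
  rw [← (LinearMap.ker p).finrank_quotient_add_finrank,
    (p.quotKerEquivOfSurjective hp).finrank_eq]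

theorem finite_ker_of_surjective [Module.Finite R U] [Projective R L] (p : U →ₗ[R] L)
    (hp : Function.Surjective p) : Module.Finite R (LinearMap.ker p) := by
  obtain ⟨e, -⟩ := p.exists_equiv_ker_prod hp
  exact Module.Finite.of_surjective (LinearMap.fst R _ _ ∘ₗ e.toLinearMap)
    (Prod.fst_surjective.comp e.surjective)

theorem finrank_quotient_torsion [IsDomain R] [Module.Finite R U] :
    finrank R (U ⧸ torsion R U) = finrank R U := by
  have h := (torsion R U).finrank_quotient_add_finrank
  have : Module.rank R (torsion R U) = 0 := by
    rw [Module.rank_eq_zero_iff_isTorsion]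
    exact Submodule.torsion_isTorsion
  rwa [show finrank R (torsion R U) = 0 by rw [finrank, this, map_zero], add_zero] at h

/-- Over a principal ideal domain, two surjections from a free module onto a free module differ by
an automorphism of the source. -/
theorem exists_equiv_comp_eq_of_free [IsDomain R] [IsPrincipalIdealRing R] [Module.Finite R U]
    [Free R U] [Module.Finite R L] [Free R L] (g h : U →ₗ[R] L) (hg : Function.Surjective g)
    (hh : Function.Surjective h) : ∃ θ : U ≃ₗ[R] U, ∀ u, h (θ u) = g u := by
  obtain ⟨e, he⟩ := g.exists_equiv_ker_prod hg
  obtain ⟨e', he'⟩ := h.exists_equiv_ker_prod hh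
  have := finite_ker_of_surjective g hg
  have := finite_ker_of_surjective h hh
  have hk : finrank R (LinearMap.ker g) = finrank R (LinearMap.ker h) := by
    have := finrank_eq_add_of_surjective g hg
    have := finrank_eq_add_of_surjective h hh
    omega
  let k := LinearEquiv.ofFinrankEq _ _ hk
  refine ⟨e ≪≫ₗ k.prodCongr (LinearEquiv.refl R L) ≪≫ₗ e'.symm, fun u => ?_⟩
  rw [← he', ← he]
  simp

/-- Over a principal ideal domain, two surjections from a finite module onto a torsion-free module
differ by an automorphism of the source. -/
theorem exists_equiv_comp_eq [IsDomain R] [IsPrincipalIdealRing R] [Module.Finite R U]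
    [Module.Finite R L] [IsTorsionFree R L] (g h : U →ₗ[R] L) (hg : Function.Surjective g)
    (hh : Function.Surjective h) : ∃ θ : U ≃ₗ[R] U, ∀ u, h (θ u) = g u := by
  have key (f : U →ₗ[R] L) : torsion R U ≤ LinearMap.ker f := fun x hx => by
    obtain ⟨a, ha⟩ := (mem_torsion_iff x).1 hx
    have : (a : R) • f x = 0 := by rw [← map_smul]; exact (congrArg f ha).trans (map_zero f)
    exact (smul_eq_zero.1 this).resolve_left (nonZeroDivisors.ne_zero a.2)
  let q := (torsion R U).mkQ
  have hq : Function.Surjective q := mkQ_surjective _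
  obtain ⟨θ, hθ⟩ := exists_equiv_comp_eq_of_free ((torsion R U).liftQ g (key g))
    ((torsion R U).liftQ h (key h))
    (LinearMap.range_eq_top.1 (by rw [range_liftQ]; exact LinearMap.range_eq_top.2 hg))
    (LinearMap.range_eq_top.1 (by rw [range_liftQ]; exact LinearMap.range_eq_top.2 hh))
  obtain ⟨e, he⟩ := q.exists_equiv_ker_prod hq
  -- The automorphism is the identity on the torsion summand, which both maps kill.
  refine ⟨e ≪≫ₗ (LinearEquiv.refl R _).prodCongr θ ≪≫ₗ e.symm, fun u => ?_⟩
  have h1 (f : U →ₗ[R] L) (v : U) : f v = (torsion R U).liftQ f (key f) (e v).2 := by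
    rw [he]; rfl
  rw [h1 h, h1 g, ← hθ]
  simp

end Splitting

/-! ### Steinitz theory of finite torsion-free modules. -/

section Dedekind

variable {R : Type*} [CommRing R] [IsDedekindDomain R]

/-- Choose `I' * I = (x)` and `I' * J + (b) = I'`. The map `(i, j) ↦ b * i / x + j` is onto because
`b * I + x * J = I * ((b) + I' * J) = (x)`. -/
theorem exists_surjective_ideal_prod_ideal (I J : Ideal R) (hI : I ≠ ⊥) (hJ : J ≠ ⊥) :
    ∃ f : (I × J) →ₗ[R] R, Function.Surjective f := by
  obtain ⟨I', hI'⟩ := ClassGroup.mk0_surjective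
    (ClassGroup.mk0 ⟨I, mem_nonZeroDivisors_of_ne_zero hI⟩)⁻¹
  obtain ⟨x, hx, hxI⟩ := ClassGroup.mk0_eq_mk0_inv_iff.1 hI'
  have hI0 : (I' : Ideal R) ≠ ⊥ := nonZeroDivisors.ne_zero I'.2
  obtain ⟨b, hb⟩ := IsDedekindDomain.exists_sup_span_eq
    (Ideal.mul_le_left : (I' : Ideal R) * J ≤ I') (mul_ne_zero hI0 hJ)
  have hbI (i : I) : ∃ c, b * i = x * c := by
    have : b * i ∈ Ideal.span {x} := hxI ▸ Ideal.mul_mem_mul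
      (hb ▸ Ideal.mem_sup_right (Ideal.mem_span_singleton_self b)) i.2
    exact Ideal.mem_span_singleton.1 this
  choose c hc using hbI
  let φ : I →ₗ[R] R :=
    { toFun := c
      map_add' := fun i j => mul_left_cancel₀ hx (by
        rw [← hc, mul_add, ← hc, ← hc, Submodule.coe_add, mul_add])
      map_smul' := fun r i => mul_left_cancel₀ hx (by
        rw [← hc, RingHom.id_apply, smul_eq_mul, mul_left_comm, ← hc, Submodule.coe_smul,
          smul_eq_mul, mul_left_comm]) }
  refine ⟨φ.coprod J.subtype, LinearMap.range_eq_top.1 ((Ideal.eq_top_iff_one _).2 ?_)⟩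
  have h1 : Ideal.span {x} * J ⊔ Ideal.span {b} * I = Ideal.span {x} := by
    conv_rhs => rw [← hxI, ← hb]
    rw [← hxI, Ideal.sup_mul, mul_right_comm]
  obtain ⟨y, hy, z, hz, hyz⟩ := Submodule.mem_sup.1
    (h1.symm ▸ Ideal.mem_span_singleton_self x)
  obtain ⟨j, hj, rfl⟩ := Ideal.mem_span_singleton_mul.1 hy
  obtain ⟨i, hi, rfl⟩ := Ideal.mem_span_singleton_mul.1 hz
  refine ⟨(⟨i, hi⟩, ⟨j, hj⟩), mul_left_cancel₀ hx ?_⟩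
  have := hc ⟨i, hi⟩
  simp only [LinearMap.coprod_apply, Submodule.subtype_apply, mul_one, mul_add]
  change x * c ⟨i, hi⟩ + x * j = x
  rw [← this, add_comm, hyz]

/-- For nonzero `c ∈ J` there is `a` with `c * I + (a) = J`; the map is `(r, i) ↦ r * a + c * i`. -/
theorem exists_surjective_prod_ideal (I J : Ideal R) (hI : I ≠ ⊥) (hJ : J ≠ ⊥) :
    ∃ f : (R × I) →ₗ[R] J, Function.Surjective f := by
  obtain ⟨c, hcJ, hc⟩ := J.exists_mem_ne_zero_of_ne_bot hJ
  obtain ⟨a, ha⟩ := IsDedekindDomain.exists_sup_span_eq (I := Ideal.span {c} * I) (J := J)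
    (Ideal.mul_le_left.trans ((Ideal.span_singleton_le_iff_mem _).2 hcJ))
    (mul_ne_zero (by simpa using hc) hI)
  have haJ : a ∈ J := ha ▸ Ideal.mem_sup_right (Ideal.mem_span_singleton_self a)
  refine ⟨LinearMap.coprod (LinearMap.toSpanSingleton R J ⟨a, haJ⟩)
    ((c • I.subtype).codRestrict J fun i => Ideal.mul_mem_right _ _ hcJ), fun ⟨y, hy⟩ => ?_⟩
  rw [← ha] at hy
  obtain ⟨u, hu, v, hv, rfl⟩ := Submodule.mem_sup.1 hy
  obtain ⟨i, hi, rfl⟩ := Ideal.mem_span_singleton_mul.1 hu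
  obtain ⟨r, rfl⟩ := Ideal.mem_span_singleton.1 hv
  refine ⟨(r, ⟨i, hi⟩), Subtype.ext ?_⟩
  simp [mul_comm a r, add_comm]

section Module

variable {P : Type*} [AddCommGroup P] [Module R P] [Module.Finite R P] [IsTorsionFree R P]

theorem IsDedekindDomain.projective_of_isTorsionFree : Projective R P :=
  have : FinitePresentation R P := finitePresentation_of_finite R P
  Flat.projective_of_finitePresentation

/-- Functionals separate the points of a projective module; the ideal is the image of a nonzero one.
-/
theorem exists_surjective_ideal [Nontrivial P] :
    ∃ I : Ideal R, I ≠ ⊥ ∧ ∃ f : P →ₗ[R] I, Function.Surjective f := by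
  have : Projective R P := IsDedekindDomain.projective_of_isTorsionFree
  obtain ⟨x, hx⟩ := exists_ne (0 : P)
  obtain ⟨f, hf⟩ : ∃ f : Dual R P, f x ≠ 0 := by
    by_contra! h
    exact hx ((forall_dual_apply_eq_zero_iff R x).1 h)
  exact ⟨LinearMap.range f, fun h => hf (LinearMap.range_eq_bot.1 h ▸ rfl),
    f.rangeRestrict, f.surjective_rangeRestrict⟩

theorem finrank_ideal (I : Ideal R) (hI : I ≠ ⊥) : finrank R I = 1 := by
  have h := Submodule.finrank_quotient_add_finrank (R := R) I
  have h0 : finrank R (R ⧸ I) = 0 := by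
    rw [Module.finrank_eq_zero_iff_isTorsion]
    obtain ⟨c, hc, hc0⟩ := I.exists_mem_ne_zero_of_ne_bot hI
    intro y
    obtain ⟨y, rfl⟩ := Ideal.Quotient.mk_surjective y
    refine ⟨⟨c, mem_nonZeroDivisors_of_ne_zero hc0⟩, ?_⟩
    change Ideal.Quotient.mk I (c * y) = 0
    exact Ideal.Quotient.eq_zero_iff_mem.2 (I.mul_mem_right _ hc)
  rw [h0, finrank_self, zero_add] at h
  exact h

theorem exists_surjective_ring_of_two_le_finrank (h : 2 ≤ finrank R P) :
    ∃ f : P →ₗ[R] R, Function.Surjective f := by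
  have : Nontrivial P := nontrivial_of_finrank_pos (R := R) (by omega)
  obtain ⟨I, hI, f, hf⟩ := exists_surjective_ideal (R := R) (P := P)
  have : Projective R I := IsDedekindDomain.projective_of_isTorsionFree
  obtain ⟨e, -⟩ := f.exists_equiv_ker_prod hf
  have hr := finrank_eq_add_of_surjective f hf
  rw [finrank_ideal I hI] at hr
  have : Nontrivial (LinearMap.ker f) := nontrivial_of_finrank_pos (R := R) (by omega)
  have := finite_ker_of_surjective f hf
  obtain ⟨J, hJ, f', hf'⟩ := exists_surjective_ideal (R := R) (P := LinearMap.ker f)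
  obtain ⟨k, hk⟩ := exists_surjective_ideal_prod_ideal J I hJ hI
  exact ⟨k ∘ₗ f'.prodMap LinearMap.id ∘ₗ e.toLinearMap,
    hk.comp ((hf'.prodMap Function.surjective_id).comp e.surjective)⟩

end Module

/-- Steinitz: a finite torsion-free module of rank `n + 1` over a Dedekind domain is the direct sum
of a free module and a nonzero ideal. -/
theorem exists_equiv_pi_prod_ideal (n : ℕ) {P : Type*} [AddCommGroup P] [Module R P]
    [Module.Finite R P] [IsTorsionFree R P] (h : finrank R P = n + 1) :
    ∃ I : Ideal R, I ≠ ⊥ ∧ Nonempty (P ≃ₗ[R] (Fin n → R) × I) := by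
  induction n generalizing P with
  | zero =>
    have : Nontrivial P := nontrivial_of_finrank_pos (R := R) (by omega)
    obtain ⟨I, hI, f, hf⟩ := exists_surjective_ideal (R := R) (P := P)
    have : Projective R I := IsDedekindDomain.projective_of_isTorsionFree
    have hr := finrank_eq_add_of_surjective f hf
    have := finite_ker_of_surjective f hf
    rw [finrank_ideal I hI, h] at hr
    have h0 : finrank R (LinearMap.ker f) = 0 := by omega
    have hk : LinearMap.ker f = ⊥ := Submodule.finrank_eq_zero.1 h0
    exact ⟨I, hI, ⟨LinearEquiv.ofBijective f ⟨LinearMap.ker_eq_bot.1 hk, hf⟩ ≪≫ₗ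
      LinearEquiv.uniqueProd.symm⟩⟩
  | succ n ih =>
    obtain ⟨f, hf⟩ := exists_surjective_ring_of_two_le_finrank (R := R) (P := P) (by omega)
    obtain ⟨e, -⟩ := f.exists_equiv_ker_prod hf
    have hr := finrank_eq_add_of_surjective f hf
    have := finite_ker_of_surjective f hf
    rw [finrank_self, h] at hr
    obtain ⟨I, hI, ⟨e'⟩⟩ := ih (P := LinearMap.ker f) (by omega)
    exact ⟨I, hI, ⟨e ≪≫ₗ LinearEquiv.prodComm R _ _ ≪≫ₗ
      (LinearEquiv.refl R R).prodCongr e' ≪≫ₗ (LinearEquiv.prodAssoc R _ _ _).symm ≪≫ₗ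
      (Fin.consLinearEquiv R (fun _ => R)).prodCongr (LinearEquiv.refl R I)⟩⟩

/-- In Steinitz form, a spare copy of `R` beside `I` lets `R × I` cover any `J`, so the classes play
no role when the rank drops. -/
theorem exists_surjective_of_finrank_lt {P Q : Type*} [AddCommGroup P] [Module R P]
    [Module.Finite R P] [IsTorsionFree R P] [AddCommGroup Q] [Module R Q]
    [Module.Finite R Q] [IsTorsionFree R Q] (h : finrank R Q < finrank R P) :
    ∃ f : P →ₗ[R] Q, Function.Surjective f := by
  obtain hQ | hQ := subsingleton_or_nontrivial Q
  · exact ⟨0, fun y => ⟨0, Subsingleton.elim _ _⟩⟩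
  have hQ0 : finrank R Q ≠ 0 := fun h0 => by
    rw [Module.finrank_eq_zero_iff_isTorsion] at h0
    obtain ⟨x, hx⟩ := exists_ne (0 : Q)
    obtain ⟨a, ha⟩ := @h0 x
    exact hx ((smul_eq_zero.1 ha).resolve_left (nonZeroDivisors.ne_zero a.2))
  obtain ⟨s, hs⟩ := Nat.exists_eq_succ_of_ne_zero hQ0
  obtain ⟨k, hk⟩ := Nat.exists_eq_add_of_lt h
  obtain ⟨J, hJ, ⟨eQ⟩⟩ := exists_equiv_pi_prod_ideal s hs
  obtain ⟨I, hI, ⟨eP⟩⟩ := exists_equiv_pi_prod_ideal (P := P) (k + s + 1)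
    (by rw [hk, hs]; omega)
  obtain ⟨f, hf⟩ := exists_surjective_prod_ideal I J hI hJ
  let p : (Fin (k + s + 1) → R) →ₗ[R] (Fin s → R) × R :=
    (LinearMap.funLeft R R (fun i : Fin s => (⟨i, by omega⟩ : Fin (k + s + 1)))).prod
      (LinearMap.proj (Fin.last (k + s)))
  have hp : Function.Surjective p := fun ⟨y, r⟩ => by
    refine ⟨fun i => if hi : (i : ℕ) < s then y ⟨i, hi⟩ else r, Prod.ext ?_ ?_⟩
    · ext i; simp [p, LinearMap.funLeft_apply]
    · simp [p]
  exact ⟨eQ.symm.toLinearMap ∘ₗ (LinearMap.id.prodMap f) ∘ₗ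
      (LinearEquiv.prodAssoc R _ _ _).toLinearMap ∘ₗ (p.prodMap LinearMap.id) ∘ₗ eP.toLinearMap,
    eQ.symm.surjective.comp ((Function.surjective_id.prodMap hf).comp
      ((LinearEquiv.prodAssoc R _ _ _).surjective.comp
        ((hp.prodMap Function.surjective_id).comp eP.surjective)))⟩

end Dedekind

/-! ### Gluing local surjections. -/

section Gluing

variable {R M N Q : Type*} [CommRing R] [AddCommGroup M] [Module R M] [AddCommGroup N]
  [Module R N] [AddCommGroup Q] [Module R Q]

/-- A linear map is surjective if it is so locally at every maximal ideal. -/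
theorem surjective_of_forall_isMaximal (f : M →ₗ[R] N)
    (hf : ∀ m : Ideal R, m.IsMaximal → ∀ y, ∃ t ∉ m, t • y ∈ LinearMap.range f) :
    Function.Surjective f := by
  intro y
  let I : Ideal R := (LinearMap.range f).comap (LinearMap.toSpanSingleton R N y)
  have hI : I = ⊤ := by
    by_contra hI
    obtain ⟨m, hm, hIm⟩ := Ideal.exists_le_maximal I hI
    obtain ⟨t, ht, hty⟩ := hf m hm y
    exact ht (hIm hty)
  have : (1 : R) ∈ I := hI ▸ mem_top
  simpa [I] using this

/-- Nakayama's lemma: surjectivity locally at a maximal ideal `m` depends on a map modulo `m`. -/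
theorem locally_surjective_of_sub_mem [Module.Finite R N] (m : Ideal R) [hm : m.IsMaximal]
    (f h : M →ₗ[R] N) (hfh : ∀ x, f x - h x ∈ m • (⊤ : Submodule R N))
    (hh : ∀ y, ∃ t ∉ m, t • y ∈ LinearMap.range h) (y : N) :
    ∃ t ∉ m, t • y ∈ LinearMap.range f := by
  have key : (⊤ : Submodule R N) ≤ LinearMap.range f ⊔ m • ⊤ := fun z _ => by
    obtain ⟨t, ht, x, hx⟩ := hh z
    obtain ⟨u, i, hi, hu⟩ := hm.exists_inv ht
    have h1 : t • z ∈ LinearMap.range f ⊔ m • ⊤ := by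
      rw [← hx, ← sub_sub_cancel (f x) (h x)]
      exact sub_mem (mem_sup_left ⟨x, rfl⟩) (mem_sup_right (hfh x))
    have h2 : z = u • t • z + i • z := by rw [← mul_smul, ← add_smul, hu, one_smul]
    rw [h2]
    exact add_mem (smul_mem _ _ h1) (mem_sup_right (smul_mem_smul hi mem_top))
  obtain ⟨r, hr, hrN⟩ := exists_sub_one_mem_and_smul_eq_zero_of_fg_of_le_smul m
    (⊤ : Submodule R (N ⧸ LinearMap.range f)) Module.Finite.fg_top (by
      have := Submodule.map_mono (f := (LinearMap.range f).mkQ) key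
      rwa [Submodule.map_sup, Submodule.map_smul'', Submodule.map_top, range_mkQ, mkQ_map_self,
        bot_sup_eq] at this)
  refine ⟨r, fun hrm => hm.ne_top ((Ideal.eq_top_iff_one m).2 ?_), ?_⟩
  · rw [← sub_sub_cancel r 1]; exact sub_mem hrm hr
  · rw [← Submodule.Quotient.mk_eq_zero, Submodule.Quotient.mk_smul]
    exact hrN _ mem_top

/-- Gluing, at finitely many maximal ideals, of locally surjective maps that agree modulo the
kernel of `π` with a given map `g` up to scalars. -/
theorem exists_surjective_of_finite_isMaximal [Module.Finite R N] (π : N →ₗ[R] Q) (g : M →ₗ[R] N)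
    (hg : Function.Surjective (π ∘ₗ g)) (X : Set (Ideal R)) (hX : X.Finite)
    (hmax : ∀ m ∈ X, m.IsMaximal)
    (hmem : ∀ m ∈ X, ∃ (h : M →ₗ[R] N) (s : R), s ∉ m ∧ π ∘ₗ h = s • (π ∘ₗ g) ∧
      ∀ y, ∃ t ∉ m, t • y ∈ LinearMap.range h)
    (hnot : ∀ m : Ideal R, m.IsMaximal → m ∉ X → ∀ y ∈ LinearMap.ker π, ∃ t ∉ m, t • y = 0) :
    ∃ f : M →ₗ[R] N, Function.Surjective f := by
  classical
  have := hX.fintype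
  choose h s hs hπ hsurj using fun m : X => hmem m m.2
  choose u i hi hu using fun m : X => (hmax m m.2).exists_inv (hs m)
  have hcop : Pairwise (Function.onFun IsCoprime fun m : X => (m : Ideal R)) := fun m m' hne =>
    have := hmax m m.2
    have := hmax m' m'.2
    Ideal.isCoprime_iff_sup_eq.2 (Ideal.IsMaximal.coprime_of_ne ‹_› ‹_› (Subtype.coe_ne_coe.2 hne))
  choose e he using fun m : X => Ideal.exists_forall_sub_mem_ideal hcop (Pi.single m (u m))
  have he1 (m : X) : 1 - e m * s m ∈ (m : Ideal R) := by
    have h1 := he m m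
    rw [Pi.single_eq_same] at h1
    have h2 : 1 - e m * s m = i m - s m * (e m - u m) := by rw [← hu m]; ring
    rw [h2]
    exact sub_mem (hi m) (Ideal.mul_mem_left _ _ h1)
  have he2 (m m' : X) (hne : m' ≠ m) : e m ∈ (m' : Ideal R) := by
    simpa [Pi.single_eq_of_ne hne] using he m m'
  -- Here `e m` inverts `s m` modulo `m` and vanishes modulo the other members of `X`, so `f ≡ e m •
  -- h m` modulo `m`. Each correction lies in the kernel of `π`, so `π ∘ f = π ∘ g`.
  let f : M →ₗ[R] N := g + ∑ m : X, e m • (h m - s m • g)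
  have hf (x : M) : f x = g x + ∑ m : X, e m • (h m x - s m • g x) := by simp [f]
  have hπf (x : M) : π (f x) = π (g x) := by
    have (m : X) : π (h m x) = s m • π (g x) := LinearMap.congr_fun (hπ m) x
    simp [hf, this]
  refine ⟨f, surjective_of_forall_isMaximal f fun m hm y => ?_⟩
  by_cases hmX : m ∈ X
  · refine locally_surjective_of_sub_mem m f (e ⟨m, hmX⟩ • h ⟨m, hmX⟩) (fun x => ?_)
      (fun z => ?_) y
    · have h1 : f x - (e ⟨m, hmX⟩ • h ⟨m, hmX⟩) x = (1 - e ⟨m, hmX⟩ * s ⟨m, hmX⟩) • g x +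
          ∑ m' ∈ Finset.univ.erase ⟨m, hmX⟩, e m' • (h m' x - s m' • g x) := by
        rw [hf, ← Finset.add_sum_erase _ _ (Finset.mem_univ (⟨m, hmX⟩ : X)), LinearMap.smul_apply]
        module
      rw [h1]
      refine add_mem (smul_mem_smul (he1 ⟨m, hmX⟩) mem_top) (sum_mem fun m' hm' => ?_)
      exact smul_mem_smul (he2 m' ⟨m, hmX⟩ (Finset.ne_of_mem_erase hm').symm) mem_top
    · obtain ⟨t, ht, x, hx⟩ := hsurj ⟨m, hmX⟩ z
      have hem : e ⟨m, hmX⟩ ∉ m := fun hem => hm.ne_top ((Ideal.eq_top_iff_one m).2 (by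
        have := add_mem (he1 ⟨m, hmX⟩) (m.mul_mem_right (s ⟨m, hmX⟩) hem)
        rwa [sub_add_cancel] at this))
      refine ⟨e ⟨m, hmX⟩ * t, fun h' => (hm.isPrime.mem_or_mem h').elim hem ht, x, ?_⟩
      rw [LinearMap.smul_apply, hx, mul_smul]
  · obtain ⟨x, hx⟩ := hg (π y)
    obtain ⟨t, ht, hty⟩ := hnot m hm hmX (y - f x) (by
      rw [LinearMap.mem_ker, map_sub, hπf, ← hx, LinearMap.comp_apply, sub_self])
    refine ⟨t, ht, t • x, ?_⟩
    rw [smul_sub, sub_eq_zero] at hty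
    rw [map_smul, hty]

end Gluing

/-! ### Lifting local surjections; torsion and associated primes. -/

section Dedekind

variable {R M N Q : Type*} [CommRing R] [IsDedekindDomain R] [AddCommGroup M] [Module R M]
  [Module.Finite R M] [AddCommGroup N] [Module R N] [AddCommGroup Q] [Module R Q]
  [Module.Finite R Q] [IsTorsionFree R Q]

/-- A surjection between localizations at a nonzero prime can be replaced by one that is compatible
with given surjections onto a torsion-free module, and lifts to a global map up to a scalar. -/
theorem exists_lift_of_surjective_localized (m : Ideal R) [m.IsPrime] (hm : m ≠ ⊥)
    (π : N →ₗ[R] Q) (hπ : Function.Surjective π) (g : M →ₗ[R] Q) (hg : Function.Surjective g)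
    (F : LocalizedModule m.primeCompl M →ₗ[Localization.AtPrime m] LocalizedModule m.primeCompl N)
    (hF : Function.Surjective F) :
    ∃ (h : M →ₗ[R] N) (s : R), s ∉ m ∧ π ∘ₗ h = s • g ∧
      ∀ y, ∃ t ∉ m, t • y ∈ LinearMap.range h := by
  have : IsDiscreteValuationRing (Localization.AtPrime m) :=
    IsLocalization.AtPrime.isDiscreteValuationRing_of_dedekind_domain R hm _
  have : FinitePresentation R M := finitePresentation_of_finite R M
  have : Module.Finite (Localization.AtPrime m) (LocalizedModule m.primeCompl M) :=
    Module.Finite.of_isLocalizedModule m.primeCompl (LocalizedModule.mkLinearMap m.primeCompl M)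
  have : Module.Finite (Localization.AtPrime m) (LocalizedModule m.primeCompl Q) :=
    Module.Finite.of_isLocalizedModule m.primeCompl (LocalizedModule.mkLinearMap m.primeCompl Q)
  let G := LocalizedModule.map m.primeCompl g
  let P := LocalizedModule.map m.primeCompl π
  have hG : Function.Surjective G := LocalizedModule.map_surjective m.primeCompl g hg
  have hP : Function.Surjective P := LocalizedModule.map_surjective m.primeCompl π hπ
  -- Both `G` and `P ∘ F` map onto the torsion-free module `Q_m` over a discrete valuation ring, so
  -- `F` can be twisted to lie over `G`.
  obtain ⟨θ, hθ⟩ := exists_equiv_comp_eq G (P ∘ₗ F) hG (hP.comp hF)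
  let F' : LocalizedModule m.primeCompl M →ₗ[R] LocalizedModule m.primeCompl N :=
    (F ∘ₗ θ.toLinearMap).restrictScalars R
  have hF' : Function.Surjective F' := hF.comp θ.surjective
  obtain ⟨h, s, hs⟩ := FinitePresentation.exists_lift_of_isLocalizedModule m.primeCompl
    (LocalizedModule.mkLinearMap m.primeCompl N)
    (F' ∘ₗ LocalizedModule.mkLinearMap m.primeCompl M)
  have hs' (x : M) : LocalizedModule.mkLinearMap m.primeCompl N (h x) =
      (s : R) • F' (LocalizedModule.mkLinearMap m.primeCompl M x) := LinearMap.congr_fun hs x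
  refine ⟨h, s, s.2, LinearMap.ext fun x => ?_, fun y => ?_⟩
  · have h1 : LocalizedModule.mkLinearMap m.primeCompl Q (π (h x)) =
        LocalizedModule.mkLinearMap m.primeCompl Q ((s : R) • g x) := by
      have h2 : LocalizedModule.mkLinearMap m.primeCompl Q (π (h x)) =
          P.restrictScalars R (LocalizedModule.mkLinearMap m.primeCompl N (h x)) := by
        simp [P]
      rw [h2, hs', map_smul, map_smul]
      congr 1
      refine (hθ _).trans ?_
      simp [G]
    obtain ⟨c, hc⟩ := (IsLocalizedModule.eq_iff_exists m.primeCompl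
      (LocalizedModule.mkLinearMap m.primeCompl Q)).1 h1
    have hc0 : (c : R) ≠ 0 := fun h0 => c.2 (h0 ▸ m.zero_mem)
    -- Torsion-freeness of `Q` cancels `c`, so the identity holds before localizing.
    exact smul_right_injective Q hc0 hc
  · obtain ⟨z, hz⟩ := hF' (LocalizedModule.mkLinearMap m.primeCompl N y)
    obtain ⟨⟨x, t⟩, hx⟩ := IsLocalizedModule.surj m.primeCompl
      (LocalizedModule.mkLinearMap m.primeCompl M) z
    have h1 : LocalizedModule.mkLinearMap m.primeCompl N (h x) =
        LocalizedModule.mkLinearMap m.primeCompl N (((s : R) * t) • y) := by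
      have hx' : (t : R) • z = LocalizedModule.mkLinearMap m.primeCompl M x := hx
      rw [hs', ← hx', map_smul, hz, map_smul, mul_smul]
    obtain ⟨c, hc⟩ := (IsLocalizedModule.eq_iff_exists m.primeCompl
      (LocalizedModule.mkLinearMap m.primeCompl N)).1 h1
    refine ⟨c * (s * t), (c * (s * t)).2, (c : R) • x, ?_⟩
    rw [map_smul]
    exact hc.trans (mul_smul (c : R) _ y).symm

/-- A maximal ideal over which a torsion element survives is an associated prime. -/
theorem mem_associatedPrimes_of_mem_torsion (m : Ideal R) [hm : m.IsMaximal] (y : N)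
    (hy : y ∈ torsion R N) (hym : ∀ t ∉ m, t • y ≠ 0) :
    m ∈ associatedPrimes R N ∧ m ≠ ⊥ := by
  obtain ⟨a, ha⟩ := (mem_torsion_iff y).1 hy
  have ha0 : (a : R) ≠ 0 := nonZeroDivisors.ne_zero a.2
  have hann (r : R) : r ∈ annihilator R (span R {y}) ↔ r • y = 0 := by
    change r ∈ (span R {y}).annihilator ↔ _
    exact mem_annihilator_span_singleton y r
  have hle : annihilator R (span R {y}) ≤ m := fun r hr => by
    by_contra hrm
    exact hym r hrm ((hann r).1 hr)
  -- `m` is minimal over the annihilator of `y`: a prime containing it contains `a ≠ 0`, hence is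
  -- maximal.
  refine ⟨associatedPrimes.subset_of_injective (span R {y}).injective_subtype
    (associatedPrimes.minimalPrimes_annihilator_subset_associatedPrimes R (span R {y})
      ⟨⟨hm.isPrime, hle⟩, fun q hq hqm => ?_⟩), ?_⟩
  · have hq0 : q ≠ ⊥ := fun h0 => ha0 (by simpa [h0] using hq.2 ((hann a).2 ha))
    exact ((hq.1.isMaximal hq0).eq_of_le hm.ne_top hqm).ge
  · rintro rfl
    exact ha0 (by simpa using hle ((hann a).2 ha))

end Dedekind

/-- A surjection onto `t ≥ 1` copies of `N` projects onto one copy. -/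
theorem surjectiveCapacity_eq_zero_iff (R M N : Type*) [CommRing R] [AddCommGroup M] [Module R M]
    [AddCommGroup N] [Module R N] :
    surjectiveCapacity R M N = 0 ↔ ¬ ∃ f : M →ₗ[R] N, Function.Surjective f := by
  simp only [surjectiveCapacity, ENat.iSup_eq_zero, Nat.cast_eq_zero]
  constructor
  · rintro h ⟨f, hf⟩
    exact one_ne_zero (h 1 ⟨(LinearEquiv.funUnique (Fin 1) R N).symm.toLinearMap ∘ₗ f,
      (LinearEquiv.funUnique (Fin 1) R N).symm.surjective.comp hf⟩)
  · rintro h t ⟨f, hf⟩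
    by_contra ht
    exact h ⟨(LinearMap.proj (R := R) (φ := fun _ => N) (⟨0, Nat.pos_of_ne_zero ht⟩ : Fin t)) ∘ₗ f,
      (LinearMap.proj_surjective (R := R) (φ := fun _ : Fin t => N) _).comp hf⟩

/-! ### Steinitz classes and surjections modulo torsion. -/

section Steinitz

variable {R M N : Type*} [CommRing R] [IsDedekindDomain R] [AddCommGroup M] [Module R M]
  [AddCommGroup N] [Module R N]

/-- The chosen ideal depends only on the predicate `RepresentsSteinitzClass`, so uniqueness of the
class is not needed. -/
theorem steinitzClass_congr (hr : finrank R M = finrank R N)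
    (e : (M ⧸ torsion R M) ≃ₗ[R] (N ⧸ torsion R N)) : steinitzClass R M = steinitzClass R N := by
  have : RepresentsSteinitzClass R M = RepresentsSteinitzClass R N := by
    funext I
    rw [RepresentsSteinitzClass, RepresentsSteinitzClass, hr]
    exact propext ⟨fun ⟨f⟩ => ⟨e.symm ≪≫ₗ f⟩, fun ⟨f⟩ => ⟨e ≪≫ₗ f⟩⟩
  unfold steinitzClass
  rw [this]

theorem exists_representsSteinitzClass [Module.Finite R M] (h : 1 ≤ finrank R M) :
    ∃ I : nonZeroDivisors (Ideal R), RepresentsSteinitzClass R M I ∧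
      steinitzClass R M = ClassGroup.mk0 I := by
  have hex : ∃ I : nonZeroDivisors (Ideal R), RepresentsSteinitzClass R M I := by
    obtain ⟨I, hI, ⟨e⟩⟩ := exists_equiv_pi_prod_ideal (R := R) (P := M ⧸ torsion R M)
      (finrank R M - 1) (by rw [finrank_quotient_torsion]; omega)
    exact ⟨⟨I, mem_nonZeroDivisors_of_ne_zero hI⟩, ⟨e⟩⟩
  exact ⟨hex.choose, hex.choose_spec, by rw [steinitzClass, dif_pos hex]⟩

theorem nonempty_equiv_of_mk0_eq_mk0 (I J : nonZeroDivisors (Ideal R))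
    (h : ClassGroup.mk0 I = ClassGroup.mk0 J) :
    Nonempty ((I : Ideal R) ≃ₗ[R] (J : Ideal R)) := by
  obtain ⟨x, y, hx, hy, hxy⟩ := ClassGroup.mk0_eq_mk0_iff.1 h
  have key (a : R) (ha : a ≠ 0) (K : Ideal R) :
      Nonempty (K ≃ₗ[R] (Ideal.span {a} * K : Ideal R)) := by
    have hinj : Function.Injective (LinearMap.lsmul R R a) := mul_right_injective₀ ha
    have : Submodule.map (LinearMap.lsmul R R a) K = Ideal.span {a} * K := by
      ext z
      simp [Ideal.mem_span_singleton_mul]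
    exact ⟨Submodule.equivMapOfInjective _ hinj K ≪≫ₗ LinearEquiv.ofEq _ _ this⟩
  obtain ⟨e⟩ := key x hx I
  obtain ⟨e'⟩ := key y hy J
  exact ⟨e ≪≫ₗ LinearEquiv.ofEq _ _ hxy ≪≫ₗ e'.symm⟩

theorem nonempty_equiv_of_steinitzClass_eq [Module.Finite R M] [Module.Finite R N]
    (hr : finrank R M = finrank R N) (h1 : 1 ≤ finrank R N)
    (h : steinitzClass R M = steinitzClass R N) :
    Nonempty ((M ⧸ torsion R M) ≃ₗ[R] (N ⧸ torsion R N)) := by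
  obtain ⟨I, ⟨eI⟩, hI⟩ := exists_representsSteinitzClass (R := R) (M := M) (hr ▸ h1)
  obtain ⟨J, ⟨eJ⟩, hJ⟩ := exists_representsSteinitzClass (R := R) (M := N) h1
  obtain ⟨e⟩ := nonempty_equiv_of_mk0_eq_mk0 I J (by rw [← hI, ← hJ, h])
  rw [hr] at eI
  exact ⟨eI ≪≫ₗ (LinearEquiv.refl R _).prodCongr e ≪≫ₗ eJ.symm⟩

variable [Module.Finite R M] [Module.Finite R N]

/-- The induced map modulo torsion has a kernel of rank zero inside a torsion-free module, so it is
an isomorphism. -/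
theorem steinitzClass_eq_of_surjective (hr : finrank R M = finrank R N) (f : M →ₗ[R] N)
    (hf : Function.Surjective f) : steinitzClass R M = steinitzClass R N := by
  have hle : torsion R M ≤ (torsion R N).comap f := fun x hx => by
    obtain ⟨a, ha⟩ := (mem_torsion_iff x).1 hx
    exact (mem_torsion_iff _).2 ⟨a, (map_smul f (a : R) x).symm.trans ((congrArg f ha).trans (map_zero f))⟩
  let f' := mapQ _ _ f hle
  have hf' : Function.Surjective f' := by
    intro y
    obtain ⟨y, rfl⟩ := mkQ_surjective _ y
    obtain ⟨x, rfl⟩ := hf y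
    exact ⟨mkQ _ x, rfl⟩
  have hk := finrank_eq_add_of_surjective f' hf'
  rw [finrank_quotient_torsion, finrank_quotient_torsion, hr] at hk
  have : Projective R (N ⧸ torsion R N) := IsDedekindDomain.projective_of_isTorsionFree
  have := finite_ker_of_surjective f' hf'
  have hk0 : LinearMap.ker f' = ⊥ :=
    Submodule.finrank_eq_zero.1 (show finrank R (LinearMap.ker f') = 0 by omega)
  exact steinitzClass_congr hr (LinearEquiv.ofBijective f' ⟨LinearMap.ker_eq_bot.1 hk0, hf'⟩)

theorem exists_surjective_quotient_torsion (hle : finrank R N ≤ finrank R M)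
    (hclass : finrank R M = finrank R N → 1 ≤ finrank R N →
      steinitzClass R M = steinitzClass R N) :
    ∃ g : M →ₗ[R] (N ⧸ torsion R N), Function.Surjective g := by
  suffices ∃ g : (M ⧸ torsion R M) →ₗ[R] (N ⧸ torsion R N), Function.Surjective g by
    obtain ⟨g, hg⟩ := this
    exact ⟨g ∘ₗ mkQ _, hg.comp (mkQ_surjective _)⟩
  obtain hlt | heq := hle.lt_or_eq
  · exact exists_surjective_of_finrank_lt (by simpa only [finrank_quotient_torsion])
  · obtain h0 | h1 := Nat.eq_zero_or_pos (finrank R N)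
    · rw [Module.finrank_eq_zero_iff_isTorsion] at h0
      refine ⟨0, fun y => ⟨0, ?_⟩⟩
      obtain ⟨z, rfl⟩ := mkQ_surjective _ y
      exact ((Submodule.Quotient.mk_eq_zero _).2 ((mem_torsion_iff z).2 (@h0 z))).symm
    · obtain ⟨e⟩ := nonempty_equiv_of_steinitzClass_eq heq.symm h1 (hclass heq.symm h1)
      exact ⟨e.toLinearMap, e.surjective⟩

end Steinitz

theorem mainTheorem12 (R M N : Type*) [CommRing R] [IsDedekindDomain R]
    [AddCommGroup M] [Module R M] [Module.Finite R M]
    [AddCommGroup N] [Module R N] [Module.Finite R N] :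
    surjectiveCapacity R M N = 0 ↔
      (∃ m : PrimeSpectrum R, m.asIdeal ∈ associatedPrimes R N ∧ m.asIdeal ≠ ⊥ ∧
          localSurjectiveCapacity R M N m = 0) ∨
        1 + Module.finrank R M ≤ Module.finrank R N ∨
        (Module.finrank R M = Module.finrank R N ∧ 1 ≤ Module.finrank R N ∧
          steinitzClass R M ≠ steinitzClass R N) := by
  simp only [localSurjectiveCapacity, surjectiveCapacity_eq_zero_iff]
  constructor
  · intro hno
    by_contra! hcon
    obtain ⟨hloc, hrank, hclass⟩ := hcon
    obtain ⟨g, hg⟩ := exists_surjective_quotient_torsion (R := R) (M := M) (N := N) (by omega)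
      hclass
    have : Projective R (N ⧸ torsion R N) := IsDedekindDomain.projective_of_isTorsionFree
    obtain ⟨σ, hσ⟩ := (torsion R N).mkQ.exists_rightInverse_of_surjective (range_mkQ _)
    have hσg : (torsion R N).mkQ ∘ₗ (σ ∘ₗ g) = g := by
      rw [← LinearMap.comp_assoc, hσ, LinearMap.id_comp]
    refine hno (exists_surjective_of_finite_isMaximal (torsion R N).mkQ (σ ∘ₗ g)
      (by rwa [hσg]) {m | m ∈ associatedPrimes R N ∧ m ≠ ⊥}
      ((associatedPrimes.finite R N).subset fun _ h => h.1)
      (fun m hm => hm.1.isPrime.isMaximal hm.2) (fun m hm => ?_) (fun m hmax hm y hy => ?_))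
    · have := hm.1.isPrime
      obtain ⟨F, hF⟩ := hloc ⟨m, this⟩ hm.1 hm.2
      rw [hσg]
      exact exists_lift_of_surjective_localized m hm.2 _ (mkQ_surjective _) g hg F hF
    · by_contra! hcon
      exact hm (mem_associatedPrimes_of_mem_torsion m y (by simpa using hy) hcon)
  · rintro h ⟨f, hf⟩
    obtain ⟨m, -, -, h⟩ | h | ⟨hr, -, h⟩ := h
    · exact h ⟨LocalizedModule.map m.asIdeal.primeCompl f,
        LocalizedModule.map_surjective m.asIdeal.primeCompl f hf⟩
    · have := LinearMap.finrank_le_finrank_of_surjective hf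
      omega
    · exact h (steinitzClass_eq_of_surjective hr f hf)
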